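/- For real $r$ let $$f(r)=\frac{4}{\pi^2}\sum_{k\ge 0}\frac{\sec((2k+1)\pi r)}{(2k+1)^2},$$ and say that $f(r)$ is defined if $\cos((2k+1)\pi r)\neq 0$ for all integers $k\ge 0$ and the series converges (as the limit of its partial sums). Let $g(r)=\dfrac{r}{1+4r}$ for $r\ne-\tfrac14$. **Theorem.** Let $s_0\in\mathbb{R}$ be given and define $s_{k+1}=g(s_k-1)$ for $k=0,1,2,\dots$ Then for every $k\ge 0$ such that $s_k\ne\tfrac34$ (so that $g(s_k-1)$ makes sense) and $s_k\neq 1$: $f(s_k)$ is defined if and only if $f(s_{k+1})$ is defined, and in that case $$f(s_{k+1})=s_{k+1}\left(2+\frac{f(s_k)}{1-s_k}\right).$$ -/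

import Mathlib

open Filter Topology

namespace SecantSeries

/-- The `k`-th term `sec((2k+1)πr) / (2k+1)²` of the series, for `k = 0, 1, 2, …`. -/
noncomputable def term (r : ℝ) (k : ℕ) : ℝ :=
  (Real.cos ((2 * (k : ℝ) + 1) * Real.pi * r))⁻¹ / (2 * (k : ℝ) + 1) ^ 2

/-- The `N`-th partial sum `∑_{k < N} sec((2k+1)πr) / (2k+1)²`. -/
noncomputable def partialSum (r : ℝ) (N : ℕ) : ℝ :=
  ∑ k ∈ Finset.range N, term r k

/-- The points `r` at which `f(r)` has a (finite) value: no term of the series is singular, and the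
series converges in the usual sense, as the limit of its partial sums. -/
def IsDefinedAt (r : ℝ) : Prop :=
  (∀ k : ℕ, Real.cos ((2 * (k : ℝ) + 1) * Real.pi * r) ≠ 0) ∧
    ∃ L : ℝ, Tendsto (partialSum r) atTop (𝓝 L)

/-- `f(r) = (4/π²) ∑_{k ≥ 0} sec((2k+1)πr) / (2k+1)²`, meaningful where `IsDefinedAt r` holds. -/
noncomputable def f (r : ℝ) : ℝ :=
  4 / Real.pi ^ 2 * limUnder atTop (partialSum r)

/-- The map `g(r) = r / (1 + 4r)`, meaningful for `r ≠ -1/4`. -/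
noncomputable def g (r : ℝ) : ℝ := r / (1 + 4 * r)

end SecantSeries

/-! Put `r = s k - 1` and `r' = g r`. Then `1/r' = 1/r + 4`, so `a = π/(2r)` and `b = π/(2r')`
satisfy `b = a + 2π`. Consequently `(tan (bw) - tan (aw)) / (w² cos (πw))` equals `2 sin (πw) / (w²
cos (aw) cos (bw))`: the poles at the zeros of `cos (πw)` cancel (`kernel_eq_tan_sub_tan`). What
remains is a pole at `0` with residue `2π`, and poles at the odd multiples of `r` and of `r'`, whose
residues are, up to constant factors, the terms of the two series. On suitable squares of half-side
`X` the kernel is `O(1/X²)` (`norm_kernel_le`), so its contour integral is `O(1/X)`. The residue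
theorem then gives `2π + 4/(πr) S_N(r) - 4/(πr') S_N'(r') → 0` for the partial sums inside the
square (`abs_partialSum_sub_partialSum_le`). The squares can be chosen so that every `N'` occurs
(`exists_abscissa`); hence convergence at `r` forces convergence at `r'` and fixes the limit
(`tendsto_partialSum_g`). The converse follows from `g (-g r) = -r` and evenness of the series; the
shift `s ↦ s - 1` only changes its sign. -/

namespace SecantSeries

open Complex Set

/-! ### Contour integrals over squares and the residue theorem for simple poles. -/

/-- The sup norm on `ℂ = ℝ²`, whose spheres are the boundaries of squares. -/
noncomputable def squareNorm (w : ℂ) : ℝ := max |w.re| |w.im|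

/-- The integral over the boundary of the square `[-X, X]²`, counterclockwise. -/
noncomputable def squareIntegral (X : ℝ) (F : ℂ → ℂ) : ℂ :=
  (∫ x : ℝ in (-X)..X, F (x + (-X : ℝ) * I)) - (∫ x : ℝ in (-X)..X, F (x + X * I)) +
    I * (∫ y : ℝ in (-X)..X, F (X + y * I)) - I * (∫ y : ℝ in (-X)..X, F ((-X : ℝ) + y * I))

section

variable {X : ℝ}

theorem squareNorm_bottom {x : ℝ} (hx : x ∈ uIcc (-X) X) :
    squareNorm (x + (-X : ℝ) * I) = |X| := by
  simp [squareNorm]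
  rcases le_total (-X) X with h | h
  · rw [uIcc_of_le h, mem_Icc, ← abs_le] at hx; exact hx.trans (le_abs_self X)
  · rw [uIcc_of_ge h] at hx; rw [abs_of_nonpos (by linarith : X ≤ 0), abs_le]; grind

theorem squareNorm_top {x : ℝ} (hx : x ∈ uIcc (-X) X) :
    squareNorm (x + X * I) = |X| := by
  simpa [squareNorm] using squareNorm_bottom hx

theorem squareNorm_right {y : ℝ} (hy : y ∈ uIcc (-X) X) :
    squareNorm (X + y * I) = |X| := by
  simpa [squareNorm, max_comm] using squareNorm_bottom hy

theorem squareNorm_left {y : ℝ} (hy : y ∈ uIcc (-X) X) :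
    squareNorm ((-X : ℝ) + y * I) = |X| := by
  simpa [squareNorm, max_comm] using squareNorm_bottom hy

theorem squareIntegral_congr (hX : 0 < X) {F G : ℂ → ℂ}
    (h : ∀ w, squareNorm w = X → F w = G w) : squareIntegral X F = squareIntegral X G := by
  rw [← abs_of_pos hX] at h
  unfold squareIntegral
  congr 1
  · congr 1
    · congr 1
      · exact intervalIntegral.integral_congr fun x hx => h _ (squareNorm_bottom hx)
      · exact intervalIntegral.integral_congr fun x hx => h _ (squareNorm_top hx)
    · congr 1
      exact intervalIntegral.integral_congr fun x hx => h _ (squareNorm_right hx)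
  · congr 1
    exact intervalIntegral.integral_congr fun x hx => h _ (squareNorm_left hx)

theorem intervalIntegrable_comp {F : ℂ → ℂ} {γ : ℝ → ℂ} (hγ : Continuous γ)
    (h : ∀ x ∈ uIcc (-X) X, ContinuousAt F (γ x)) :
    IntervalIntegrable (fun x => F (γ x)) MeasureTheory.volume (-X) X :=
  ContinuousOn.intervalIntegrable fun x hx =>
    ((h x hx).comp (f := γ) hγ.continuousAt).continuousWithinAt

theorem squareIntegral_sub_const_mul (hX : 0 < X) {F G : ℂ → ℂ} (c : ℂ)
    (hF : ∀ w, squareNorm w = X → ContinuousAt F w)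
    (hG : ∀ w, squareNorm w = X → ContinuousAt G w) :
    squareIntegral X (fun w => F w - c * G w) =
      squareIntegral X F - c * squareIntegral X G := by
  rw [← abs_of_pos hX] at hF hG
  unfold squareIntegral
  have e : ∀ γ : ℝ → ℂ, Continuous γ → (∀ x ∈ uIcc (-X) X, squareNorm (γ x) = |X|) →
      ∫ x in (-X)..X, (F (γ x) - c * G (γ x)) =
        (∫ x in (-X)..X, F (γ x)) - c * ∫ x in (-X)..X, G (γ x) := by
    intro γ hγ h
    rw [intervalIntegral.integral_sub, intervalIntegral.integral_const_mul]
    · exact intervalIntegrable_comp hγ fun x hx => hF _ (h x hx)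
    · exact (intervalIntegrable_comp hγ fun x hx => hG _ (h x hx)).const_mul c
  rw [e (fun x => x + (-X : ℝ) * I) (by fun_prop) fun x hx => squareNorm_bottom hx,
    e (fun x => x + X * I) (by fun_prop) fun x hx => squareNorm_top hx,
    e (fun x => X + x * I) (by fun_prop) fun x hx => squareNorm_right hx,
    e (fun x => (-X : ℝ) + x * I) (by fun_prop) fun x hx => squareNorm_left hx]
  ring

theorem norm_squareIntegral_le (hX : 0 < X) {F : ℂ → ℂ} {C : ℝ}
    (h : ∀ w, squareNorm w = X → ‖F w‖ ≤ C) : ‖squareIntegral X F‖ ≤ 8 * X * C := by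
  rw [← abs_of_pos hX] at h
  unfold squareIntegral
  have e : ∀ γ : ℝ → ℂ, (∀ x ∈ uIcc (-X) X, squareNorm (γ x) = |X|) →
      ‖∫ x in (-X)..X, F (γ x)‖ ≤ 2 * X * C := by
    intro γ hγ
    refine (intervalIntegral.norm_integral_le_of_norm_le_const fun x hx =>
      h _ (hγ x (uIoc_subset_uIcc hx))).trans_eq ?_
    rw [sub_neg_eq_add, abs_of_pos (by linarith)]
    ring
  refine (norm_sub_le _ _).trans ?_
  refine (add_le_add_left (norm_add_le _ _) _).trans ?_
  refine (add_le_add_left (add_le_add_left (norm_sub_le _ _) _) _).trans ?_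
  rw [norm_mul, norm_mul, norm_I, one_mul, one_mul]
  have h1 := e (fun x => x + (-X : ℝ) * I) fun x hx => squareNorm_bottom hx
  have h2 := e (fun x => x + X * I) fun x hx => squareNorm_top hx
  have h3 := e (fun x => X + x * I) fun x hx => squareNorm_right hx
  have h4 := e (fun x => (-X : ℝ) + x * I) fun x hx => squareNorm_left hx
  linarith

theorem hasDerivAt_ofReal (x : ℝ) : HasDerivAt (fun x : ℝ => (x : ℂ)) 1 x := by
  simpa using (hasDerivAt_id x).ofReal_comp

/-- The factor `σ` turns the segment away from the branch cut, so that `log (σ * γ x)` is a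
primitive. -/
theorem integral_inv_segment {γ : ℝ → ℂ} {v σ : ℂ} {a b : ℝ} (hσ : σ ≠ 0)
    (hγ : ∀ x, HasDerivAt γ v x) (h : ∀ x ∈ uIcc a b, σ * γ x ∈ slitPlane) :
    v * ∫ x in a..b, (γ x)⁻¹ = log (σ * γ b) - log (σ * γ a) := by
  rw [← intervalIntegral.integral_const_mul]
  refine intervalIntegral.integral_eq_sub_of_hasDerivAt (f := fun x => log (σ * γ x)) ?_ ?_
  · intro x hx
    have := ((hγ x).const_mul σ).clog_real (h x hx)
    have h0 : γ x ≠ 0 := fun h' => by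
      have := slitPlane_ne_zero (h x hx); simp [h'] at this
    rw [mul_div_mul_left _ _ hσ, div_eq_mul_inv] at this
    exact this
  · refine ContinuousOn.intervalIntegrable fun x hx => ?_
    have h0 : γ x ≠ 0 := fun h' => by
      have := slitPlane_ne_zero (h x hx); simp [h'] at this
    exact ((hγ x).continuousAt.inv₀ h0).const_mul v |>.continuousWithinAt

/-- Seen from `p`, only the left side crosses the cut of `log`. There `log (-(w - p))` serves
instead, and the jumps of `π * I` at its two ends add up to `2 * π * I` while all other terms
cancel. -/
theorem squareIntegral_inv_sub {p : ℂ} (hp : squareNorm p < X) :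
    squareIntegral X (fun w => (w - p)⁻¹) = 2 * Real.pi * I := by
  obtain ⟨h1, h2⟩ := max_lt_iff.1 hp
  rw [abs_lt] at h1 h2
  have hX : -X ≤ X := by linarith
  have b := integral_inv_segment (γ := fun x : ℝ => x + (-X : ℝ) * I - p) (v := 1) (σ := 1)
    (a := -X) (b := X) one_ne_zero
    (fun x => (((hasDerivAt_ofReal x).add_const _).sub_const p))
    (fun x hx => by
      right; simp; linarith)
  have t := integral_inv_segment (γ := fun x : ℝ => x + X * I - p) (v := 1) (σ := 1)
    (a := -X) (b := X) one_ne_zero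
    (fun x => (((hasDerivAt_ofReal x).add_const _).sub_const p))
    (fun x hx => by
      right; simp; linarith)
  have r := integral_inv_segment (γ := fun x : ℝ => X + x * I - p) (v := I) (σ := 1)
    (a := -X) (b := X) one_ne_zero
    (fun x => by
      simpa using ((((hasDerivAt_ofReal x).mul_const I).const_add (X : ℂ)).sub_const p))
    (fun x hx => by
      left; simp; linarith)
  have l := integral_inv_segment (γ := fun x : ℝ => (-X : ℝ) + x * I - p) (v := I) (σ := -1)
    (a := -X) (b := X) (by simp)
    (fun x => by
      simpa using ((((hasDerivAt_ofReal x).mul_const I).const_add ((-X : ℝ) : ℂ)).sub_const p))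
    (fun x hx => by
      left; simp; linarith)
  unfold squareIntegral
  rw [one_mul] at b t
  rw [b, t, r, l]
  have l1 : log (-1 * ((-X : ℝ) + X * I - p)) = log ((-X : ℝ) + X * I - p) - Real.pi * I := by
    rw [neg_one_mul, log, log, norm_neg, arg_neg_eq_arg_sub_pi_of_im_pos (by simp; linarith)]
    push_cast; ring
  have l2 : log (-1 * ((-X : ℝ) + (-X : ℝ) * I - p)) =
      log ((-X : ℝ) + (-X : ℝ) * I - p) + Real.pi * I := by
    rw [neg_one_mul, log, log, norm_neg, arg_neg_eq_arg_add_pi_of_im_neg (by simp; linarith)]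
    push_cast; ring
  rw [l1, l2]
  simp only [one_mul]
  ring

theorem continuous_squareNorm : Continuous squareNorm := by
  unfold squareNorm
  fun_prop

/-- The **residue theorem** for a square and finitely many simple poles. -/
theorem squareIntegral_eq_sum_residues (hX : 0 < X) (S : Finset ℂ) : ∀ (F c : ℂ → ℂ),
    (∀ p ∈ S, squareNorm p < X) →
    (∀ w, squareNorm w ≤ X → w ∉ S → DifferentiableAt ℂ F w) →
    (∀ p ∈ S, Tendsto (fun w => (w - p) * F w) (𝓝[≠] p) (𝓝 (c p))) →
    squareIntegral X F = 2 * Real.pi * I * ∑ p ∈ S, c p := by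
  induction S using Finset.induction_on with
  | empty =>
    intro F c _ hd _
    have := integral_boundary_rect_eq_zero_of_differentiableOn F ⟨-X, -X⟩ ⟨X, X⟩ (by
      intro w hw
      refine (hd w ?_ (by simp)).differentiableWithinAt
      rw [mem_reProdIm] at hw
      have hX' : -X ≤ X := by linarith
      simp only [uIcc_of_le hX', mem_Icc, ← abs_le] at hw
      exact max_le hw.1 hw.2)
    simpa [squareIntegral] using this
  | insert p S hpS ih =>
    intro F c hS hd hc
    set G : ℂ → ℂ := fun w => F w - c p * (w - p)⁻¹ with hG
    have hpX := hS p (Finset.mem_insert_self _ _)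
    -- Subtracting the polar part leaves a removable singularity at `p`; filling it in gives a
    -- function with poles only in `S`.
    set H : ℂ → ℂ := Function.update G p (limUnder (𝓝[≠] p) G) with hH
    have hGd : ∀ w, squareNorm w ≤ X → w ∉ S → w ≠ p → DifferentiableAt ℂ G w := by
      intro w hw hwS hwp
      refine (hd w hw (by simp [hwS, hwp])).sub (DifferentiableAt.const_mul ?_ _)
      exact (differentiableAt_id.sub_const p).inv (sub_ne_zero.2 hwp)
    have hHG : ∀ w, w ≠ p → H =ᶠ[𝓝 w] G := fun w hw => by
      filter_upwards [isOpen_ne.mem_nhds hw] with z hz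
      exact Function.update_of_ne hz _ _
    have hHd : ∀ w, squareNorm w ≤ X → w ∉ S → DifferentiableAt ℂ H w := by
      intro w hw hwS
      by_cases hwp : w = p
      · subst hwp
        have hU : {z | squareNorm z < X ∧ z ∉ S} ∈ 𝓝 w := by
          refine (IsOpen.inter (isOpen_lt continuous_squareNorm continuous_const)
            S.finite_toSet.isClosed.isOpen_compl).mem_nhds ⟨hpX, hwS⟩
        refine (differentiableOn_update_limUnder_of_isLittleO hU ?_ ?_).differentiableAt hU
        · intro z hz
          exact (hGd z hz.1.1.le hz.1.2 hz.2).differentiableWithinAt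
        -- Removability: `(z - w) * G z` tends to `c w - c w = 0`.
        · have h0 : ∀ᶠ z in 𝓝[≠] w, z - w ≠ 0 := by
            filter_upwards [self_mem_nhdsWithin] with z hz using sub_ne_zero.2 hz
          rw [Asymptotics.isLittleO_iff_tendsto' (h0.mono fun z hz h => absurd (inv_eq_zero.1 h) hz)]
          have h1 := hc w (Finset.mem_insert_self _ _)
          have h2 : Tendsto (fun z => (z - w) * F z - c w - (z - w) * G w) (𝓝[≠] w)
              (𝓝 (c w - c w - (w - w) * G w)) := by
            refine (h1.sub_const _).sub (Tendsto.mul_const _ ?_)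
            exact ((continuous_id.sub continuous_const).tendsto w).mono_left nhdsWithin_le_nhds
          simp only [sub_self, zero_mul] at h2
          refine h2.congr' (h0.mono fun z hz => ?_)
          simp only [hG, div_inv_eq_mul, sub_mul]
          field_simp
      · exact (hGd w hw hwS hwp).congr_of_eventuallyEq (hHG w hwp)
    have hHc : ∀ q ∈ S, Tendsto (fun w => (w - q) * H w) (𝓝[≠] q) (𝓝 (c q)) := by
      intro q hq
      have hqp : q ≠ p := fun h => hpS (h ▸ hq)
      have h1 := hc q (Finset.mem_insert_of_mem hq)
      have h2 : Tendsto (fun z => (z - q) * F z - (z - q) * (c p * (z - p)⁻¹)) (𝓝[≠] q)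
          (𝓝 (c q - (q - q) * (c p * (q - p)⁻¹))) := by
        refine h1.sub (Tendsto.mono_left ?_ nhdsWithin_le_nhds)
        have : ContinuousAt (fun z => (z - q) * (c p * (z - p)⁻¹)) q := by
          have := sub_ne_zero.2 hqp
          fun_prop (disch := assumption)
        exact this
      simp only [sub_self, zero_mul, sub_zero] at h2
      refine h2.congr' (((hHG q hqp).filter_mono nhdsWithin_le_nhds).mono fun z hz => ?_)
      simp only [hz, hG]
      ring
    have key := ih H c (fun q hq => hS q (Finset.mem_insert_of_mem hq)) hHd hHc
    have hbd : ∀ w, squareNorm w = X → w ∉ insert p S :=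
      fun w hw hwS => (hS w hwS).ne hw
    have hbp : ∀ w, squareNorm w = X → w ≠ p := fun w hw h => by
      rw [h] at hw; exact hpX.ne hw
    rw [squareIntegral_congr hX (G := G) fun w hw => Function.update_of_ne (hbp w hw) _ _, hG,
      squareIntegral_sub_const_mul hX (G := fun w => (w - p)⁻¹) _ (fun w hw => (hd w hw.le (hbd w hw)).continuousAt)
        (fun w hw => ContinuousAt.inv₀ (by fun_prop) (sub_ne_zero.2 (hbp w hw))),
      squareIntegral_inv_sub hpX] at key
    rw [Finset.sum_insert hpS]
    linear_combination key

end

end SecantSeries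

namespace SecantSeries

open Complex Set

/-! ### Size of the kernel on the boundary of a square. -/

theorem normSq_cos (w : ℂ) :
    ‖cos w‖ ^ 2 = (Real.cos w.re * Real.cosh w.im) ^ 2 + (Real.sin w.re * Real.sinh w.im) ^ 2 := by
  rw [← normSq_eq_norm_sq, cos_eq, ← ofReal_cos, ← ofReal_cosh, ← ofReal_sin, ← ofReal_sinh,
    ← ofReal_mul, ← ofReal_mul, sub_eq_add_neg, ← neg_mul, ← ofReal_neg, normSq_add_mul_I, neg_sq]

theorem normSq_sin (w : ℂ) :
    ‖sin w‖ ^ 2 = (Real.sin w.re * Real.cosh w.im) ^ 2 + (Real.cos w.re * Real.sinh w.im) ^ 2 := by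
  rw [← normSq_eq_norm_sq, sin_eq, ← ofReal_cos, ← ofReal_cosh, ← ofReal_sin, ← ofReal_sinh,
    ← ofReal_mul, ← ofReal_mul, normSq_add_mul_I]

theorem abs_cos_mul_cosh_le_norm_cos (w : ℂ) :
    |Real.cos w.re| * Real.cosh w.im ≤ ‖cos w‖ := by
  refine le_of_sq_le_sq ?_ (norm_nonneg _)
  rw [normSq_cos, mul_pow, sq_abs, mul_pow]
  nlinarith [sq_nonneg (Real.sin w.re * Real.sinh w.im)]

theorem abs_sinh_le_norm_cos (w : ℂ) : |Real.sinh w.im| ≤ ‖cos w‖ := by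
  refine le_of_sq_le_sq ?_ (norm_nonneg _)
  rw [normSq_cos, sq_abs, mul_pow, mul_pow, Real.cosh_sq]
  nlinarith [sq_nonneg (Real.cos w.re), Real.sin_sq_add_cos_sq w.re]

theorem norm_sin_le_cosh (w : ℂ) : ‖sin w‖ ≤ Real.cosh w.im := by
  refine le_of_sq_le_sq ?_ (Real.cosh_pos _).le
  rw [normSq_sin, mul_pow, mul_pow, Real.cosh_sq]
  nlinarith [sq_nonneg (Real.cos w.re), Real.sin_sq_add_cos_sq w.re]

theorem cosh_le_two_mul_abs_sinh {u : ℝ} (hu : 1 ≤ |u|) : Real.cosh u ≤ 2 * |Real.sinh u| := by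
  refine le_of_sq_le_sq ?_ (by positivity)
  have : |u| ≤ |Real.sinh u| := by
    rw [Real.abs_sinh]
    exact Real.self_le_sinh_iff.2 (abs_nonneg u)
  rw [Real.cosh_sq, mul_pow, ← sq_abs (Real.sinh u)]
  nlinarith

/-- On the vertical sides `|cos (aX)|` is the controlling factor; on the horizontal ones `|sinh
(aX)|` is at least half of `cosh (aX)`, whence the condition `d ≤ 1 / 2`. -/
theorem mul_cosh_le_norm_cos_of_squareNorm_eq {a d X : ℝ} {w : ℂ} (hd' : d ≤ 1 / 2)
    (hX : 0 < X) (haX : 1 ≤ |a| * X) (hcos : d ≤ |Real.cos (a * X)|) (hw : squareNorm w = X) :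
    d * Real.cosh (a * w.im) ≤ ‖cos (a * w)‖ := by
  have hc := Real.cosh_pos (a * w.im)
  rcases max_choice |w.re| |w.im| with h | h
  · have h' : |w.re| = X := h.symm.trans hw
    have key := abs_cos_mul_cosh_le_norm_cos (a * w)
    rw [re_ofReal_mul, im_ofReal_mul] at key
    refine le_trans (mul_le_mul_of_nonneg_right ?_ hc.le) key
    rcases abs_eq hX.le |>.1 h' with h'' | h'' <;> rw [h'']
    · exact hcos
    · rwa [mul_neg, Real.cos_neg]
  · have h' : |w.im| = X := h.symm.trans hw
    have key := abs_sinh_le_norm_cos (a * w)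
    rw [im_ofReal_mul] at key
    have := cosh_le_two_mul_abs_sinh (u := a * w.im) (by rwa [abs_mul, h'])
    nlinarith

/-- The difference of `tan (bw) / (w² cos (πw))` and `tan (aw) / (w² cos (πw))` when
`b = a + 2π`, in a form where the poles at the zeros of `cos (πw)` are cancelled. -/
noncomputable def kernel (a b : ℝ) (w : ℂ) : ℂ :=
  2 * sin (Real.pi * w) / (w ^ 2 * (cos (a * w) * cos (b * w)))

theorem norm_kernel_le {a b d X : ℝ} {w : ℂ} (hab : b = a + 2 * Real.pi) (hd : 0 < d)
    (hd' : d ≤ 1 / 2) (hX : 0 < X) (haX : 1 ≤ |a| * X) (hbX : 1 ≤ |b| * X)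
    (hcosa : d ≤ |Real.cos (a * X)|) (hcosb : d ≤ |Real.cos (b * X)|) (hw : squareNorm w = X) :
    ‖kernel a b w‖ ≤ 4 / (X ^ 2 * d ^ 2) := by
  have ha := mul_cosh_le_norm_cos_of_squareNorm_eq hd' hX haX hcosa hw
  have hb := mul_cosh_le_norm_cos_of_squareNorm_eq hd' hX hbX hcosb hw
  have hs := norm_sin_le_cosh (Real.pi * w)
  rw [im_ofReal_mul] at hs
  have hwX : X ≤ ‖w‖ := hw ▸ max_le (abs_re_le_norm w) (abs_im_le_norm w)
  -- Since `b - a = 2π`, the product-to-sum formula shows that the two cosines in the denominator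
  -- outgrow `sin (πw)`.
  have hprod : Real.cosh (Real.pi * w.im) ≤
      2 * (Real.cosh (a * w.im) * Real.cosh (b * w.im)) := by
    have h1 : Real.cosh (Real.pi * w.im) ≤ Real.cosh (2 * Real.pi * w.im) := by
      rw [Real.cosh_le_cosh, abs_mul, abs_mul, abs_of_pos Real.two_pi_pos, abs_of_pos Real.pi_pos]
      nlinarith [Real.pi_pos, abs_nonneg w.im]
    have h2 : Real.cosh (b * w.im + a * w.im) + Real.cosh (b * w.im - a * w.im) =
        2 * (Real.cosh (a * w.im) * Real.cosh (b * w.im)) := by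
      rw [Real.cosh_add, Real.cosh_sub]; ring
    have h3 : b * w.im - a * w.im = 2 * Real.pi * w.im := by rw [hab]; ring
    rw [h3] at h2
    have := Real.cosh_pos (b * w.im + a * w.im)
    linarith
  have hca := Real.cosh_pos (a * w.im)
  have hcb := Real.cosh_pos (b * w.im)
  rw [kernel, norm_div, norm_mul, norm_mul, norm_mul, norm_pow, norm_ofNat]
  calc 2 * ‖sin (Real.pi * w)‖ / (‖w‖ ^ 2 * (‖cos (a * w)‖ * ‖cos (b * w)‖))
      ≤ 2 * (2 * (Real.cosh (a * w.im) * Real.cosh (b * w.im))) /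
          (X ^ 2 * ((d * Real.cosh (a * w.im)) * (d * Real.cosh (b * w.im)))) := by
        gcongr
        exact hs.trans hprod
    _ = 4 / (X ^ 2 * d ^ 2) := by
        field_simp
        norm_num

/-! ### Poles and residues of the kernel. -/

theorem hasDerivAt_cos_const_mul (a : ℝ) (p : ℂ) :
    HasDerivAt (fun w : ℂ => cos (a * w)) (-sin (a * p) * a) p := by
  simpa using ((hasDerivAt_id p).const_mul (a : ℂ)).ccos

theorem sin_ne_zero_of_cos_eq_zero {z : ℂ} (h : cos z = 0) : sin z ≠ 0 := by
  rcases cos_eq_zero_iff_sin_eq.1 h with h | h <;> simp [h]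

theorem eventually_cos_const_mul_ne_zero {a : ℝ} (ha : a ≠ 0) (p : ℂ) :
    ∀ᶠ w in 𝓝[≠] p, cos (a * w) ≠ 0 := by
  by_cases h : cos (a * p) = 0
  · refine (hasDerivAt_cos_const_mul a p).eventually_ne ?_
    simp [sin_ne_zero_of_cos_eq_zero h, ha]
  · exact ((hasDerivAt_cos_const_mul a p).continuousAt.eventually_ne h).filter_mono
      nhdsWithin_le_nhds

open Classical in
theorem tendsto_sub_mul_tan {a : ℝ} (ha : a ≠ 0) (p : ℂ) :
    Tendsto (fun w : ℂ => (w - p) * tan (a * w)) (𝓝[≠] p)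
      (𝓝 (if cos (a * p) = 0 then -(1 / (a : ℂ)) else 0)) := by
  have ha' : (a : ℂ) ≠ 0 := by exact_mod_cast ha
  have hsin : Tendsto (fun w : ℂ => sin (a * w)) (𝓝[≠] p) (𝓝 (sin (a * p))) := by
    have : Continuous fun w : ℂ => sin (a * w) := by fun_prop
    exact (this.tendsto p).mono_left nhdsWithin_le_nhds
  split_ifs with h
  · have hs := sin_ne_zero_of_cos_eq_zero h
    have h1 := (hasDerivAt_iff_tendsto_slope.1 (hasDerivAt_cos_const_mul a p)).inv₀
      (by simp [hs, ha])
    have h2 := h1.mul hsin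
    have e : (-sin (a * p) * a)⁻¹ * sin (a * p) = -(1 / (a : ℂ)) := by field_simp
    rw [e] at h2
    refine h2.congr fun w => ?_
    rw [slope_def_field, h, sub_zero, inv_div, tan]
    ring
  · have hcos : Tendsto (fun w : ℂ => cos (a * w)) (𝓝[≠] p) (𝓝 (cos (a * p))) :=
      (hasDerivAt_cos_const_mul a p).continuousAt.tendsto.mono_left nhdsWithin_le_nhds
    have hid : Tendsto (fun w : ℂ => w - p) (𝓝[≠] p) (𝓝 (p - p)) :=
      ((continuous_id.sub continuous_const).tendsto p).mono_left nhdsWithin_le_nhds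
    simpa [tan] using hid.mul (hsin.div hcos h)

open Classical in
/-- The residue of `kernel a b` at a point `p` of `ℂ`. -/
noncomputable def kernelResidue (a b : ℝ) (p : ℂ) : ℂ :=
  if p = 0 then 2 * Real.pi else
    (if cos (a * p) = 0 then (p ^ 2 * cos (Real.pi * p))⁻¹ / a else 0) -
      (if cos (b * p) = 0 then (p ^ 2 * cos (Real.pi * p))⁻¹ / b else 0)

theorem kernel_eq_tan_sub_tan {a b : ℝ} (hab : b = a + 2 * Real.pi) {w : ℂ}
    (ha : cos (a * w) ≠ 0) (hb : cos (b * w) ≠ 0) (hπ : cos (Real.pi * w) ≠ 0) :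
    kernel a b w = (tan (b * w) - tan (a * w)) * (w ^ 2 * cos (Real.pi * w))⁻¹ := by
  have key : sin (b * w) * cos (a * w) - cos (b * w) * sin (a * w) =
      2 * sin (Real.pi * w) * cos (Real.pi * w) := by
    rw [← sin_sub, ← sin_two_mul, hab]
    congr 1
    push_cast
    ring
  rw [tan, tan, div_sub_div _ _ hb ha, key, kernel]
  -- At `w = 0` both sides are `0`, by the convention for division by zero.
  by_cases hw : w = 0
  · simp [hw]
  field_simp

/-- Away from `0` the tangent form makes the residue additive, so a common zero of `cos (aw)` and
`cos (bw)` needs no separate treatment. -/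
theorem tendsto_sub_mul_kernel {a b : ℝ} (hab : b = a + 2 * Real.pi) (ha : a ≠ 0) (hb : b ≠ 0)
    {p : ℂ} (hp : p ≠ 0 → cos (Real.pi * p) ≠ 0) :
    Tendsto (fun w => (w - p) * kernel a b w) (𝓝[≠] p) (𝓝 (kernelResidue a b p)) := by
  by_cases h0 : p = 0
  · subst h0
    rw [kernelResidue, if_pos rfl]
    have h1 : HasDerivAt (fun w : ℂ => sin (Real.pi * w)) Real.pi 0 := by
      simpa using ((hasDerivAt_id (0 : ℂ)).const_mul (Real.pi : ℂ)).csin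
    have h2 := hasDerivAt_iff_tendsto_slope.1 h1
    have h3 : Tendsto (fun w : ℂ => 2 / (cos (a * w) * cos (b * w))) (𝓝[≠] 0) (𝓝 2) := by
      have : ContinuousAt (fun w : ℂ => 2 / (cos (a * w) * cos (b * w))) 0 := by
        refine ContinuousAt.div (by fun_prop) (by fun_prop) (by simp)
      have := this.tendsto.mono_left (nhdsWithin_le_nhds (s := {0}ᶜ))
      simpa using this
    refine (h3.mul h2).congr' ?_
    filter_upwards [self_mem_nhdsWithin] with w hw
    have hw : w ≠ 0 := hw
    rw [slope_def_field, kernel]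
    simp only [mul_zero, sin_zero, sub_zero]
    by_cases hc : cos (a * w) * cos (b * w) = 0
    · simp [hc]
    field_simp
  · have hcos := hp h0
    have h1 := (tendsto_sub_mul_tan hb p).sub (tendsto_sub_mul_tan ha p)
    have h2 : Tendsto (fun w : ℂ => (w ^ 2 * cos (Real.pi * w))⁻¹) (𝓝[≠] p)
        (𝓝 (p ^ 2 * cos (Real.pi * p))⁻¹) := by
      have : ContinuousAt (fun w : ℂ => (w ^ 2 * cos (Real.pi * w))⁻¹) p :=
        ContinuousAt.inv₀ (by fun_prop) (by simp [h0, hcos])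
      exact this.tendsto.mono_left nhdsWithin_le_nhds
    have h3 := h1.mul h2
    have e : kernelResidue a b p = ((if cos (b * p) = 0 then -(1 / (b : ℂ)) else 0) -
        (if cos (a * p) = 0 then -(1 / (a : ℂ)) else 0)) * (p ^ 2 * cos (Real.pi * p))⁻¹ := by
      rw [kernelResidue, if_neg h0]
      split_ifs <;> ring
    rw [e]
    refine h3.congr' ?_
    filter_upwards [eventually_cos_const_mul_ne_zero ha p, eventually_cos_const_mul_ne_zero hb p,
      eventually_cos_const_mul_ne_zero Real.pi_ne_zero p] with w h4 h5 h6
    rw [kernel_eq_tan_sub_tan hab h4 h5 h6]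
    ring

theorem differentiableAt_kernel {a b : ℝ} {w : ℂ} (h0 : w ≠ 0) (ha : cos (a * w) ≠ 0)
    (hb : cos (b * w) ≠ 0) : DifferentiableAt ℂ (kernel a b) w := by
  unfold kernel
  refine DifferentiableAt.div (by fun_prop) (by fun_prop) (by simp [h0, ha, hb])

/-! ### Odd multiples of `r` inside a square, and the sum of their residues. -/

/-- The points `r (2k + 1)` with `-N ≤ k < N`. -/
noncomputable def oddMultiples (r : ℝ) (N : ℕ) : Finset ℂ :=
  (Finset.Ico (-N : ℤ) N).image fun k : ℤ => ((r * (2 * k + 1) : ℝ) : ℂ)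

section oddMultiples

variable {r X : ℝ} {N : ℕ} {p : ℂ}

theorem cos_eq_zero_iff_exists_odd_multiple (hr : r ≠ 0) :
    cos ((Real.pi / (2 * r) : ℝ) * p) = 0 ↔ ∃ k : ℤ, p = ((r * (2 * k + 1) : ℝ) : ℂ) := by
  rw [cos_eq_zero_iff]
  refine exists_congr fun k => ?_
  have h1 : (r : ℂ) ≠ 0 := by exact_mod_cast hr
  have h2 : (Real.pi : ℂ) ≠ 0 := by exact_mod_cast Real.pi_ne_zero
  push_cast
  rw [div_mul_eq_mul_div, div_eq_div_iff (by simp [h1]) (by simp)]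
  constructor
  · intro h
    refine mul_left_cancel₀ (mul_ne_zero h2 two_ne_zero) ?_
    linear_combination h
  · rintro rfl
    ring

theorem squareNorm_ofReal (x : ℝ) : squareNorm (x : ℂ) = |x| := by simp [squareNorm]

theorem squareNorm_lt_of_mem_oddMultiples (hN : (2 * N - 1) * |r| < X)
    (hp : p ∈ oddMultiples r N) : squareNorm p < X := by
  obtain ⟨k, hk, rfl⟩ := Finset.mem_image.1 hp
  rw [Finset.mem_Ico] at hk
  rw [squareNorm_ofReal, abs_mul]
  refine lt_of_le_of_lt ?_ hN
  rw [mul_comm]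
  refine mul_le_mul_of_nonneg_right ?_ (abs_nonneg r)
  have : |2 * k + 1| ≤ 2 * (N : ℤ) - 1 := by rw [abs_le]; omega
  exact_mod_cast this

theorem cos_eq_zero_of_mem_oddMultiples (hr : r ≠ 0) (hp : p ∈ oddMultiples r N) :
    cos ((Real.pi / (2 * r) : ℝ) * p) = 0 := by
  obtain ⟨k, hk, rfl⟩ := Finset.mem_image.1 hp
  exact (cos_eq_zero_iff_exists_odd_multiple hr).2 ⟨k, rfl⟩

theorem mem_oddMultiples_of_cos_eq_zero (hr : r ≠ 0) (hN : X < (2 * N + 1) * |r|)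
    (hp : squareNorm p ≤ X) (h : cos ((Real.pi / (2 * r) : ℝ) * p) = 0) :
    p ∈ oddMultiples r N := by
  obtain ⟨k, rfl⟩ := (cos_eq_zero_iff_exists_odd_multiple hr).1 h
  rw [squareNorm_ofReal, abs_mul] at hp
  have h1 : |2 * (k : ℝ) + 1| < 2 * N + 1 := by
    refine lt_of_mul_lt_mul_right ?_ (abs_nonneg r)
    rw [mul_comm]
    exact hp.trans_lt hN
  have h2 : |2 * k + 1| < 2 * (N : ℤ) + 1 := by exact_mod_cast h1
  rw [abs_lt] at h2
  exact Finset.mem_image.2 ⟨k, Finset.mem_Ico.2 (by omega), rfl⟩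

/-- The reflection `k ↦ -k - 1` replaces `2k + 1` by its negative, which pairs the poles `p` and
`-p`. -/
theorem sum_Ico_neg_of_reflect {h : ℤ → ℂ} (hh : ∀ k, h (-k - 1) = h k) (N : ℕ) :
    ∑ k ∈ Finset.Ico (-N : ℤ) N, h k = 2 * ∑ k ∈ Finset.range N, h k := by
  induction N with
  | zero => simp
  | succ N ih =>
    have e : Finset.Ico (-(N + 1 : ℕ) : ℤ) (N + 1 : ℕ) =
        insert (-(N : ℤ) - 1) (insert (N : ℤ) (Finset.Ico (-N : ℤ) N)) := by
      ext x; simp only [Finset.mem_Ico, Finset.mem_insert]; omega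
    rw [e, Finset.sum_insert (by simp), Finset.sum_insert (by simp), ih, hh,
      Finset.sum_range_succ]
    ring

theorem sum_oddMultiples (hr : r ≠ 0) :
    ∑ p ∈ oddMultiples r N, (p ^ 2 * cos (Real.pi * p))⁻¹ / (Real.pi / (2 * r) : ℝ) =
      (4 / (Real.pi * r) * partialSum r N : ℝ) := by
  have h1 : (r : ℂ) ≠ 0 := by exact_mod_cast hr
  rw [oddMultiples, Finset.sum_image, sum_Ico_neg_of_reflect, partialSum, Finset.mul_sum,
    Finset.mul_sum, ofReal_sum]
  · refine Finset.sum_congr rfl fun k _ => ?_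
    rw [term]
    push_cast
    rw [show (Real.pi : ℂ) * (r * (2 * k + 1)) = (2 * k + 1) * Real.pi * r by ring]
    -- A singular term is `0` on both sides, because `0⁻¹ = 0`.
    by_cases hc : cos ((2 * k + 1) * Real.pi * r : ℂ) = 0
    · simp [hc]
    have h2 : (2 * k + 1 : ℂ) ≠ 0 := by exact_mod_cast Nat.succ_ne_zero (2 * k)
    have h3 : (Real.pi : ℂ) ≠ 0 := by exact_mod_cast Real.pi_ne_zero
    field_simp
    norm_num
  · intro k
    have e : ((r * (2 * ((-k - 1 : ℤ) : ℝ) + 1) : ℝ) : ℂ) = -((r * (2 * (k : ℝ) + 1) : ℝ) : ℂ) := by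
      push_cast; ring
    rw [e, neg_sq, mul_neg, cos_neg]
  · intro k _ l _ h
    have := mul_left_cancel₀ hr (ofReal_injective h)
    exact_mod_cast (mul_left_cancel₀ two_ne_zero (add_right_cancel this) : (k : ℝ) = l)

end oddMultiples

/-- The comparison of partial sums obtained by integrating `kernel` around a square. -/
theorem abs_partialSum_sub_partialSum_le {r r' d X : ℝ} {N N' : ℕ} (hr : r ≠ 0) (hr' : r' ≠ 0)
    (hrr : Real.pi / (2 * r') = Real.pi / (2 * r) + 2 * Real.pi)
    (hπ : ∀ k : ℤ, Real.cos ((2 * k + 1) * Real.pi * r) ≠ 0)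
    (hπ' : ∀ k : ℤ, Real.cos ((2 * k + 1) * Real.pi * r') ≠ 0)
    (hd : 0 < d) (hd' : d ≤ 1 / 2) (hX : 0 < X)
    (haX : 1 ≤ |Real.pi / (2 * r)| * X) (hbX : 1 ≤ |Real.pi / (2 * r')| * X)
    (hcosa : d ≤ |Real.cos (Real.pi / (2 * r) * X)|)
    (hcosb : d ≤ |Real.cos (Real.pi / (2 * r') * X)|)
    (hN : (2 * N - 1) * |r| < X) (hN₁ : X < (2 * N + 1) * |r|)
    (hN' : (2 * N' - 1) * |r'| < X) (hN'₁ : X < (2 * N' + 1) * |r'|) :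
    2 * Real.pi * |2 * Real.pi + 4 / (Real.pi * r) * partialSum r N -
      4 / (Real.pi * r') * partialSum r' N'| ≤ 8 * X * (4 / (X ^ 2 * d ^ 2)) := by
  classical
  have hπA : ∀ {ρ : ℝ} {M : ℕ} {p : ℂ}, (∀ k : ℤ, Real.cos ((2 * k + 1) * Real.pi * ρ) ≠ 0) →
      p ∈ oddMultiples ρ M → cos (Real.pi * p) ≠ 0 := by
    intro ρ M p h hp
    obtain ⟨k, -, rfl⟩ := Finset.mem_image.1 hp
    rw [← ofReal_mul, ← ofReal_cos, ofReal_ne_zero]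
    convert h k using 2
    ring
  have h0A : ∀ {ρ : ℝ} {M : ℕ}, ρ ≠ 0 → (0 : ℂ) ∉ oddMultiples ρ M := by
    intro ρ M hρ h
    simpa using cos_eq_zero_of_mem_oddMultiples hρ h
  have res := squareIntegral_eq_sum_residues hX
    (insert 0 (oddMultiples r N ∪ oddMultiples r' N'))
    (kernel (Real.pi / (2 * r)) (Real.pi / (2 * r')))
    (kernelResidue (Real.pi / (2 * r)) (Real.pi / (2 * r')))
    (by
      intro p hp
      rw [Finset.mem_insert, Finset.mem_union] at hp
      rcases hp with rfl | hp | hp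
      · simpa [squareNorm] using hX
      · exact squareNorm_lt_of_mem_oddMultiples hN hp
      · exact squareNorm_lt_of_mem_oddMultiples hN' hp)
    (by
      intro w hw hwS
      rw [Finset.mem_insert, Finset.mem_union, not_or, not_or] at hwS
      exact differentiableAt_kernel hwS.1
        (fun h => hwS.2.1 (mem_oddMultiples_of_cos_eq_zero hr hN₁ hw h))
        (fun h => hwS.2.2 (mem_oddMultiples_of_cos_eq_zero hr' hN'₁ hw h)))
    (by
      intro p hp
      refine tendsto_sub_mul_kernel hrr (by simp [hr]) (by simp [hr']) fun h0 => ?_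
      rw [Finset.mem_insert, Finset.mem_union] at hp
      rcases hp with hp | hp | hp
      · exact absurd hp h0
      · exact hπA hπ hp
      · exact hπA hπ' hp)
  -- `T` will be the union of both families of poles. The condition on the cosine selects one
  -- family, so a point common to both enters both sums.
  have sumA : ∀ {ρ : ℝ} {M : ℕ} (T : Finset ℂ), ρ ≠ 0 → (∀ p ∈ T, squareNorm p < X) →
      oddMultiples ρ M ⊆ T → X < (2 * M + 1) * |ρ| →
      ∑ p ∈ T, (if cos ((Real.pi / (2 * ρ) : ℝ) * p) = 0 then
        (p ^ 2 * cos (Real.pi * p))⁻¹ / (Real.pi / (2 * ρ) : ℝ) else 0) =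
      (4 / (Real.pi * ρ) * partialSum ρ M : ℝ) := by
    intro ρ M T hρ hT hsub hM
    rw [← Finset.sum_filter, ← sum_oddMultiples hρ]
    refine Finset.sum_congr ?_ fun _ _ => rfl
    ext p
    rw [Finset.mem_filter]
    exact ⟨fun h => mem_oddMultiples_of_cos_eq_zero hρ hM (hT p h.1).le h.2,
      fun h => ⟨hsub h, cos_eq_zero_of_mem_oddMultiples hρ h⟩⟩
  have hlt : ∀ p ∈ oddMultiples r N ∪ oddMultiples r' N', squareNorm p < X := fun p hp =>
    (Finset.mem_union.1 hp).elim (squareNorm_lt_of_mem_oddMultiples hN)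
      (squareNorm_lt_of_mem_oddMultiples hN')
  have hnot : (0 : ℂ) ∉ oddMultiples r N ∪ oddMultiples r' N' := fun h =>
    (Finset.mem_union.1 h).elim (h0A hr) (h0A hr')
  have hres : ∀ p ∈ oddMultiples r N ∪ oddMultiples r' N',
      kernelResidue (Real.pi / (2 * r)) (Real.pi / (2 * r')) p =
      (if cos ((Real.pi / (2 * r) : ℝ) * p) = 0 then
        (p ^ 2 * cos (Real.pi * p))⁻¹ / (Real.pi / (2 * r) : ℝ) else 0) -
      (if cos ((Real.pi / (2 * r') : ℝ) * p) = 0 then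
        (p ^ 2 * cos (Real.pi * p))⁻¹ / (Real.pi / (2 * r') : ℝ) else 0) := by
    intro p hp
    have hp0 : p ≠ 0 := by
      rintro rfl
      exact hnot hp
    rw [kernelResidue, if_neg hp0]
  rw [Finset.sum_insert hnot, Finset.sum_congr rfl hres,
    Finset.sum_sub_distrib, sumA _ hr hlt Finset.subset_union_left hN₁,
    sumA _ hr' hlt Finset.subset_union_right hN'₁, kernelResidue, if_pos rfl] at res
  have bound := norm_squareIntegral_le hX fun w hw =>
    norm_kernel_le hrr hd hd' hX haX hbX hcosa hcosb hw
  rw [res] at bound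
  refine le_of_eq_of_le ?_ bound
  rw [norm_mul, norm_mul, norm_mul, norm_I, norm_ofNat, norm_real, Real.norm_of_nonneg
    Real.pi_pos.le, mul_one, ← Real.norm_eq_abs, ← norm_real]
  congr 2
  push_cast
  ring

end SecantSeries

namespace SecantSeries

open Set

/-! ### Choice of squares that keep away from the poles. -/

theorem abs_sin_le_abs_cos_add_abs_cos (x y : ℝ) :
    |Real.sin y| ≤ |Real.cos x| + |Real.cos (x + y)| := by
  have e : Real.sin y = Real.sin (x + y) * Real.cos x - Real.cos (x + y) * Real.sin x := by
    rw [← Real.sin_sub]; ring_nf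
  rw [e]
  refine (abs_sub _ _).trans ?_
  rw [abs_mul, abs_mul]
  have h1 := Real.abs_sin_le_one (x + y)
  have h2 := Real.abs_sin_le_one x
  nlinarith [abs_nonneg (Real.cos x), abs_nonneg (Real.cos (x + y))]

theorem abs_cos_pi_div_two_mul (r m : ℝ) (hr : r ≠ 0) :
    |Real.cos (Real.pi / (2 * r) * (m * |r|))| = |Real.cos (m * Real.pi / 2)| := by
  rcases abs_choice r with h | h
  · rw [h]; congr 2; field_simp
  · rw [h, ← Real.cos_neg]; congr 2; field_simp

/-- The nonvanishing cosine says that `X` is not an odd multiple of `|r|`, so both inequalities are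
strict. -/
theorem exists_nat_between_odd_multiples {r X : ℝ} (hr : r ≠ 0) (hX : 0 < X)
    (hcos : Real.cos (Real.pi / (2 * r) * X) ≠ 0) :
    ∃ N : ℕ, (2 * N - 1) * |r| < X ∧ X < (2 * N + 1) * |r| := by
  have hr' : 0 < |r| := abs_pos.2 hr
  have h0 : 0 ≤ (X / |r| + 1) / 2 := by positivity
  refine ⟨⌊(X / |r| + 1) / 2⌋₊, lt_of_le_of_ne ?_ ?_, ?_⟩
  · have := Nat.floor_le h0
    rw [← le_div_iff₀ hr']
    linarith
  · intro h
    refine hcos ?_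
    rw [← abs_eq_zero, ← h, abs_cos_pi_div_two_mul _ _ hr, abs_eq_zero, Real.cos_eq_zero_iff]
    exact ⟨(⌊(X / |r| + 1) / 2⌋₊ : ℤ) - 1, by push_cast; ring⟩
  · have := Nat.lt_floor_add_one ((X / |r| + 1) / 2)
    rw [← div_lt_iff₀ hr']
    linarith

/-- The bound `d` is uniform, and every positive `N'` is served: this is what later yields
convergence of the full sequence of partial sums at `r'`, not just of a subsequence. -/
theorem exists_abscissa (r r' : ℝ) (hr : r ≠ 0) (hr' : r' ≠ 0) :
    ∃ d : ℝ, 0 < d ∧ d ≤ 1 / 2 ∧ ∀ N' : ℕ, 0 < N' → ∃ X : ℝ, ∃ N : ℕ, 2 * N' * |r'| ≤ X ∧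
      d ≤ |Real.cos (Real.pi / (2 * r) * X)| ∧ d ≤ |Real.cos (Real.pi / (2 * r') * X)| ∧
      (2 * N - 1) * |r| < X ∧ X < (2 * N + 1) * |r| ∧
      (2 * N' - 1) * |r'| < X ∧ X < (2 * N' + 1) * |r'| := by
  set a := Real.pi / (2 * r) with ha
  set b := Real.pi / (2 * r') with hb
  have ha0 : 0 < |a| := by simp [ha, hr]
  have hb0 : 0 < |b| := by simp [hb, hr']
  have hρ : 0 < |r'| := abs_pos.2 hr'
  -- A shift so short that `|a * t|` and `|b * t|` are at most `1`: then `sin (a * t)` and `cos (b *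
  -- t)` are nonzero, and `t < |r'|`, so no pole of the second family is crossed.
  set t := 1 / (|a| + |b|) with ht
  have ht0 : 0 < t := by positivity
  have hat : |a * t| ≤ 1 := by
    rw [abs_mul, abs_of_pos ht0, ht, mul_one_div, div_le_one (by positivity)]
    linarith
  have hbt : |b * t| ≤ 1 := by
    rw [abs_mul, abs_of_pos ht0, ht, mul_one_div, div_le_one (by positivity)]
    linarith
  have hπ := Real.pi_gt_three
  have hsin : 0 < |Real.sin (a * t)| := by
    rw [abs_pos, Ne, Real.sin_eq_zero_iff_of_lt_of_lt (by linarith [abs_le.1 hat])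
      (by linarith [abs_le.1 hat])]
    exact mul_ne_zero (abs_pos.1 ha0) ht0.ne'
  have hcos : 0 < |Real.cos (b * t)| := by
    refine abs_pos.2 (Real.cos_pos_of_mem_Ioo ⟨?_, ?_⟩).ne' <;> linarith [abs_le.1 hbt]
  have htρ : t < |r'| := by
    have e : |b| * |r'| = Real.pi / 2 := by
      rw [← abs_mul, hb, show Real.pi / (2 * r') * r' = Real.pi / 2 by field_simp,
        abs_of_pos (by positivity)]
    rw [abs_mul, abs_of_pos ht0] at hbt
    refine lt_of_mul_lt_mul_left ?_ hb0.le
    linarith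
  refine ⟨min (1 / 2) (min (|Real.sin (a * t)| / 2) |Real.cos (b * t)|), by positivity,
    min_le_left _ _, fun N' hN' => ?_⟩
  set d := min (1 / 2) (min (|Real.sin (a * t)| / 2) |Real.cos (b * t)|) with hd
  have hd0 : 0 < d := by positivity
  have hd1 : d ≤ 1 / 2 := min_le_left _ _
  have hd2 : d ≤ |Real.sin (a * t)| / 2 := (min_le_right _ _).trans (min_le_left _ _)
  have hd3 : d ≤ |Real.cos (b * t)| := (min_le_right _ _).trans (min_le_right _ _)
  have hN'0 : (0 : ℝ) < N' := by exact_mod_cast hN'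
  set X₀ := 2 * N' * |r'| with hX₀
  have hX₀0 : 0 < X₀ := by positivity
  have hc0 : |Real.cos (b * X₀)| = 1 := by
    rw [hb, hX₀, abs_cos_pi_div_two_mul _ _ hr', mul_div_right_comm, mul_div_cancel_left₀ _
      two_ne_zero]
    exact_mod_cast Real.abs_cos_int_mul_pi N'
  have hs0 : Real.sin (b * X₀) = 0 := by
    have := Real.sin_sq_add_cos_sq (b * X₀)
    rw [← sq_abs (Real.cos _), hc0] at this
    exact pow_eq_zero_iff two_ne_zero |>.1 (by linarith)
  -- At `X₀` the cosine for `b` is `±1`, so only the one for `a` can be small. If it is below `d ≤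
  -- |sin (a * t)| / 2`, then at `X₀ + t` it is at least `d`.
  obtain ⟨X, hX1, hX2, hXa, hXb⟩ : ∃ X, X₀ ≤ X ∧ X ≤ X₀ + t ∧ d ≤ |Real.cos (a * X)| ∧
      d ≤ |Real.cos (b * X)| := by
    by_cases h : d ≤ |Real.cos (a * X₀)|
    · exact ⟨X₀, le_rfl, by linarith, h, by rw [hc0]; linarith⟩
    · refine ⟨X₀ + t, by linarith, le_rfl, ?_, ?_⟩
      · have := abs_sin_le_abs_cos_add_abs_cos (a * X₀) (a * t)
        rw [mul_add]
        linarith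
      · rwa [mul_add, Real.cos_add, hs0, zero_mul, sub_zero, abs_mul, hc0, one_mul]
  obtain ⟨N, hN, hN₁⟩ := exists_nat_between_odd_multiples hr (hX₀0.trans_le hX1)
    (fun h => by rw [h, abs_zero] at hXa; linarith)
  refine ⟨X, N, hX1, hXa, hXb, hN, hN₁, ?_, ?_⟩ <;> rw [hX₀] at * <;> linarith

/-! ### Transfer of definedness and limits from `r` to `g r`. -/

theorem cos_int_ne_zero {r : ℝ}
    (h : ∀ k : ℕ, Real.cos ((2 * (k : ℝ) + 1) * Real.pi * r) ≠ 0) (k : ℤ) :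
    Real.cos ((2 * (k : ℝ) + 1) * Real.pi * r) ≠ 0 := by
  cases k with
  | ofNat n => simpa using h n
  | negSucc n =>
    have e : (2 * ((Int.negSucc n : ℤ) : ℝ) + 1) * Real.pi * r =
        -((2 * (n : ℝ) + 1) * Real.pi * r) := by
      rw [Int.cast_negSucc]; push_cast; ring
    rw [e, Real.cos_neg]
    exact h n

theorem cos_g_ne_zero {r : ℝ} (hg : 1 + 4 * r ≠ 0)
    (h : ∀ k : ℕ, Real.cos ((2 * (k : ℝ) + 1) * Real.pi * r) ≠ 0) (k : ℕ) :
    Real.cos ((2 * (k : ℝ) + 1) * Real.pi * g r) ≠ 0 := by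
  intro hk
  obtain ⟨m, hm⟩ := Real.cos_eq_zero_iff.1 hk
  -- Clearing denominators in `(2k + 1) r / (1 + 4r) = (2m + 1) / 2` gives `(2(k - 2m - 1) + 1) r =
  -- (2m + 1) / 2`; this index may be negative.
  refine cos_int_ne_zero h (k - 2 * m - 1) (Real.cos_eq_zero_iff.2 ⟨m, ?_⟩)
  rw [g, mul_div_assoc', div_eq_div_iff hg two_ne_zero] at hm
  push_cast
  linear_combination hm / 2

/-- The index at `g r` runs through all `n`, while the matching index `N n` at `r` merely tends to
infinity, which suffices because convergence at `r` is assumed. -/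
theorem tendsto_partialSum_g {r L : ℝ} (hr : r ≠ 0) (hg : 1 + 4 * r ≠ 0)
    (h : ∀ k : ℕ, Real.cos ((2 * (k : ℝ) + 1) * Real.pi * r) ≠ 0)
    (hL : Tendsto (partialSum r) atTop (𝓝 L)) :
    Tendsto (partialSum (g r)) atTop (𝓝 (g r * (Real.pi ^ 2 / 2 + L / r))) := by
  have hgr : g r ≠ 0 := div_ne_zero hr hg
  have hπ := cos_int_ne_zero h
  have hπ' := cos_int_ne_zero (cos_g_ne_zero hg h)
  have hrr : Real.pi / (2 * g r) = Real.pi / (2 * r) + 2 * Real.pi := by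
    rw [g]; field_simp; ring
  obtain ⟨d, hd, hd', hd2⟩ := exists_abscissa r (g r) hr hgr
  set r' := g r with hr'def
  have hr0 : 0 < |r| := abs_pos.2 hr
  have hr'0 : 0 < |r'| := abs_pos.2 hgr
  choose! X N hX hcosa hcosb hN hN₁ hN' hN'₁ using hd2
  have hXtop : Tendsto X atTop atTop := by
    refine tendsto_atTop_mono' atTop ((eventually_gt_atTop 0).mono fun n hn => hX n hn) ?_
    exact (tendsto_natCast_atTop_atTop.const_mul_atTop two_pos).atTop_mul_const hr'0
  have hNtop : Tendsto N atTop atTop := by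
    rw [← tendsto_natCast_atTop_iff (R := ℝ)]
    have h1 : Tendsto (fun n => (X n / |r| - 1) / 2) atTop atTop :=
      (tendsto_atTop_add_const_right _ (-1) (hXtop.atTop_div_const hr0)).atTop_div_const two_pos
    refine tendsto_atTop_mono' atTop ((eventually_gt_atTop 0).mono fun n hn => ?_) h1
    have := (div_lt_iff₀ hr0).2 (hN₁ n hn)
    linarith
  have hlim : Tendsto (fun n => 2 * Real.pi + 4 / (Real.pi * r) * partialSum r (N n) -
      4 / (Real.pi * r') * partialSum r' n) atTop (𝓝 0) := by
    have h1 : Tendsto (fun n => 16 / (Real.pi * d ^ 2) * (X n)⁻¹) atTop (𝓝 0) := by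
      simpa using (tendsto_inv_atTop_zero.comp hXtop).const_mul (16 / (Real.pi * d ^ 2))
    refine squeeze_zero_norm' ?_ h1
    have ha0 : 0 < |Real.pi / (2 * r)| := by simp [hr]
    have hb0 : 0 < |Real.pi / (2 * r')| := by simp [hgr]
    filter_upwards [eventually_gt_atTop 0, hXtop.eventually_gt_atTop 0,
      (hXtop.const_mul_atTop ha0).eventually_ge_atTop 1,
      (hXtop.const_mul_atTop hb0).eventually_ge_atTop 1] with n hn h0 h2 h3
    have := abs_partialSum_sub_partialSum_le hr hgr hrr hπ hπ' hd hd' h0 h2 h3 (hcosa n hn)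
      (hcosb n hn) (hN n hn) (hN₁ n hn) (hN' n hn) (hN'₁ n hn)
    rw [Real.norm_eq_abs]
    refine le_of_mul_le_mul_left (this.trans_eq ?_) Real.two_pi_pos
    field_simp
    norm_num
  have h4 := (((hL.comp hNtop).const_mul (4 / (Real.pi * r))).const_add (2 * Real.pi)).sub hlim
    |>.const_mul (Real.pi * r' / 4)
  have e : Real.pi * r' / 4 * (2 * Real.pi + 4 / (Real.pi * r) * L - 0) =
      r' * (Real.pi ^ 2 / 2 + L / r) := by
    field_simp
    ring
  rw [e] at h4
  refine h4.congr fun n => ?_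
  simp only [Function.comp_apply]
  field_simp
  ring

theorem isDefinedAt_g {r : ℝ} (hr : r ≠ 0) (hg : 1 + 4 * r ≠ 0) (h : IsDefinedAt r) :
    IsDefinedAt (g r) := by
  obtain ⟨h1, L, hL⟩ := h
  exact ⟨cos_g_ne_zero hg h1, _, tendsto_partialSum_g hr hg h1 hL⟩

/-! ### Symmetries of the series: negation, inversion of `g`, and the unit shift. -/

theorem partialSum_neg (r : ℝ) : partialSum (-r) = partialSum r := by
  funext N
  refine Finset.sum_congr rfl fun k _ => ?_
  rw [term, term, mul_neg, Real.cos_neg]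

theorem isDefinedAt_neg {r : ℝ} : IsDefinedAt (-r) ↔ IsDefinedAt r := by
  simp only [IsDefinedAt, partialSum_neg, mul_neg, Real.cos_neg]

/-- Negation conjugates `g` to its inverse, so the converse is the forward implication at `-g r`. -/
theorem isDefinedAt_g_iff {r : ℝ} (hr : r ≠ 0) (hg : 1 + 4 * r ≠ 0) :
    IsDefinedAt (g r) ↔ IsDefinedAt r := by
  refine ⟨fun h => ?_, isDefinedAt_g hr hg⟩
  have e : 1 + 4 * -g r = (1 + 4 * r)⁻¹ := by
    rw [g]; field_simp; ring
  have e' : g (-g r) = -r := by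
    rw [g, e, g, div_inv_eq_mul, neg_mul, div_mul_cancel₀ _ hg]
  rw [← isDefinedAt_neg, ← e']
  exact isDefinedAt_g (neg_ne_zero.2 (div_ne_zero hr hg)) (e ▸ inv_ne_zero hg)
    (isDefinedAt_neg.2 h)

theorem cos_odd_mul_pi_mul_sub_one (s : ℝ) (k : ℕ) :
    Real.cos ((2 * (k : ℝ) + 1) * Real.pi * (s - 1)) =
      -Real.cos ((2 * (k : ℝ) + 1) * Real.pi * s) := by
  rw [show (2 * (k : ℝ) + 1) * Real.pi * (s - 1) =
    (2 * (k : ℝ) + 1) * Real.pi * s - Real.pi - k * (2 * Real.pi) by ring,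
    Real.cos_sub_nat_mul_two_pi, Real.cos_sub_pi]

theorem partialSum_sub_one (s : ℝ) (N : ℕ) : partialSum (s - 1) N = -partialSum s N := by
  rw [partialSum, partialSum, ← Finset.sum_neg_distrib]
  refine Finset.sum_congr rfl fun k _ => ?_
  rw [term, term, cos_odd_mul_pi_mul_sub_one, inv_neg, neg_div]

theorem isDefinedAt_sub_one {s : ℝ} : IsDefinedAt (s - 1) ↔ IsDefinedAt s := by
  have e : partialSum (s - 1) = fun N => -partialSum s N := funext (partialSum_sub_one s)
  simp only [IsDefinedAt, cos_odd_mul_pi_mul_sub_one, neg_ne_zero, e]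
  refine and_congr_right fun _ => ⟨fun ⟨L, hL⟩ => ⟨-L, ?_⟩, fun ⟨L, hL⟩ => ⟨-L, hL.neg⟩⟩
  simpa using hL.neg

end SecantSeries

theorem theorem4p1 (s : ℕ → ℝ) (hs : ∀ k : ℕ, s (k + 1) = SecantSeries.g (s k - 1)) (k : ℕ)
    (hg : 1 + 4 * (s k - 1) ≠ 0) (h1 : s k ≠ 1) :
    (SecantSeries.IsDefinedAt (s k) ↔ SecantSeries.IsDefinedAt (s (k + 1))) ∧
      (SecantSeries.IsDefinedAt (s k) →
        SecantSeries.f (s (k + 1)) = s (k + 1) * (2 + SecantSeries.f (s k) / (1 - s k))) := by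
  have hr : s k - 1 ≠ 0 := sub_ne_zero.2 h1
  rw [hs k]
  refine ⟨by rw [SecantSeries.isDefinedAt_g_iff hr hg, SecantSeries.isDefinedAt_sub_one],
    fun hdef => ?_⟩
  obtain ⟨L, hL⟩ := hdef.2
  have hL' : Tendsto (SecantSeries.partialSum (s k - 1)) atTop (𝓝 (-L)) :=
    hL.neg.congr fun N => (SecantSeries.partialSum_sub_one (s k) N).symm
  have hlim := SecantSeries.tendsto_partialSum_g hr hg
    (SecantSeries.isDefinedAt_sub_one.2 hdef).1 hL'
  rw [SecantSeries.f, SecantSeries.f, hlim.limUnder_eq, hL.limUnder_eq]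
  have hr' : 1 - s k ≠ 0 := sub_ne_zero.2 h1.symm
  -- The sign from the unit shift turns the denominator `s k - 1` into `1 - s k`.
  have e : -L / (s k - 1) = L / (1 - s k) := by
    rw [← neg_sub 1 (s k), neg_div_neg_eq]
  rw [e]
  field_simp
  ring
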